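/- Let $d\ge 0$ and $N\ge 0$ be integers and let $\kappa,R>0$ be real numbers. A periodic point set in Euclidean space $\mathbb{R}^d$ is a set $X=\Lambda+P=\{\lambda+x:\lambda\in\Lambda,\ x\in P\}$, where $\Lambda=\mathbb{Z}v_1+\dots+\mathbb{Z}v_d$ is the lattice generated by a basis $v_1,\dots,v_d$ of $\mathbb{R}^d$ and the motif $P$ is a finite nonempty subset of the unit cell $U(\Lambda)=\{\sum_i t_iv_i : t_i\in[0,1)\}$; such $\Lambda$ (with its generators) and $P$ are called representatives of $X$. The density of $X$ is $|P|/\mathrm{Vol}(U(\Lambda))$, which does not depend on the representatives, and its covering radius is $\sup_{y\in\mathbb{R}^d}\inf_{x\in X}\|x-y\|$. For $X,Y\subseteq\mathbb{R}^d$ let $d_B(X,Y)=\inf_f\sup_{x\in X}\|x-f(x)\|$, the infimum being over all bijections $f\colon X\to Y$ (and $\infty$ if there is none), and let the Euclidean bottleneck distance be $d_{EB}(X,Y)=\inf_\psi d_B(X,\psi(Y))$, the infimum being over all isometries $\psi$ of $\mathbb{R}^d$. Let $\mathcal{F}$ be the family of all periodic point sets $X$ in $\mathbb{R}^d$ of density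 $\kappa$ and covering radius less than $R$ that have representatives $\Lambda,P$ with $|P|\le N$. Then: (1) There is a constant $K=K(d,\kappa,R,N)>0$ such that $d_{EB}(X_1,X_2)\le K$ for all $X_1,X_2\in\mathcal{F}$. (2) Consequently $(\mathcal{F},d_{EB})$ coarsely embeds into every real Hilbert space $H$ by collapsing it to a point: $d_{EB}$ is finite on $\mathcal{F}$, and for every $h\in H$ the constant map $f\colon\mathcal{F}\to H$, $f\equiv h$, is a coarse embedding, that is, there are nondecreasing functions $\rho_-,\rho_+\colon[0,\infty)\to[0,\infty)$ with $\lim_{t\to\infty}\rho_-(t)=\infty$ and $\rho_-(d_{EB}(X,Y))\le\|f(X)-f(Y)\|\le\rho_+(d_{EB}(X,Y))$ for all $X,Y\in\mathcal{F}$. -/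

import Mathlib

open scoped NNReal ENNReal Pointwise

noncomputable section

namespace PeriodicSets

/-- The space `ℝ^d` with its Euclidean norm. -/
abbrev Space (d : ℕ) : Type := EuclideanSpace ℝ (Fin d)

/-- The lattice generated by a basis `v` of `ℝ^d`: all integer combinations of the `v i`. -/
def lattice {d : ℕ} (v : Module.Basis (Fin d) ℝ (Space d)) : Set (Space d) :=
  (Submodule.span ℤ (Set.range v) : Set (Space d))

/-- The half-open unit cell `{∑ tᵢ vᵢ | tᵢ ∈ [0, 1)}` of the lattice generated by `v`. -/
def unitCell {d : ℕ} (v : Module.Basis (Fin d) ℝ (Space d)) : Set (Space d) :=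
  ZSpan.fundamentalDomain v

/-- The lattice `Λ` generated by `v` and the motif `P` are representatives of `X`:
`P` is a finite nonempty subset of the unit cell and `X = Λ + P`. -/
structure IsRepresentedBy {d : ℕ} (X : Set (Space d))
    (v : Module.Basis (Fin d) ℝ (Space d)) (P : Finset (Space d)) : Prop where
  motif_nonempty : P.Nonempty
  motif_subset : (P : Set (Space d)) ⊆ unitCell v
  eq_add : X = lattice v + (P : Set (Space d))

/-- `X` is a periodic point set of `ℝ^d`. -/
def IsPeriodicPointSet {d : ℕ} (X : Set (Space d)) : Prop :=
  ∃ v P, IsRepresentedBy X v P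

/-- `X` is a periodic point set of density `κ = |P| / Vol(U(Λ))`, computed from some
representatives of `X` (the value does not depend on the representatives). -/
def HasDensity {d : ℕ} (X : Set (Space d)) (κ : ℝ) : Prop :=
  ∃ v P, IsRepresentedBy X v P ∧ κ = (P.card : ℝ) / MeasureTheory.volume.real (unitCell v)

/-- The covering radius `sup_y inf_{x ∈ X} ‖x - y‖`, with value `∞` for the empty set. -/
def coveringRadius {d : ℕ} (X : Set (Space d)) : ℝ≥0∞ :=
  ⨆ y : Space d, ⨅ x ∈ X, edist y x

/-- The bottleneck distance: the infimum over all bijections `f : X → Y` of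
`sup_{x ∈ X} ‖x - f x‖`, with value `∞` if there is no bijection. -/
def bottleneckDist {d : ℕ} (X Y : Set (Space d)) : ℝ≥0∞ :=
  ⨅ f : X ≃ Y, ⨆ x : X, edist (x : Space d) (f x : Space d)

/-- The Euclidean bottleneck distance: the infimum over all isometries `ψ` of `ℝ^d` of the
bottleneck distance between `X` and `ψ(Y)`. -/
def euclideanBottleneckDist {d : ℕ} (X Y : Set (Space d)) : ℝ≥0∞ :=
  ⨅ ψ : Space d ≃ᵢ Space d, bottleneckDist X (ψ '' Y)

/-- The periodic point sets of `ℝ^d` of density `κ` and covering radius less than `R`. -/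
def periodicPointSets (d : ℕ) (κ R : ℝ) : Set (Set (Space d)) :=
  {X | IsPeriodicPointSet X ∧ HasDensity X κ ∧ coveringRadius X < ENNReal.ofReal R}

/-- The members of `periodicPointSets d κ R` that have representatives whose motif has at most
`N` points. -/
def boundedMotifSets (d : ℕ) (κ R : ℝ) (N : ℕ) : Set (Set (Space d)) :=
  {X | X ∈ periodicPointSets d κ R ∧ ∃ v P, IsRepresentedBy X v P ∧ P.card ≤ N}

/-- The map `f` from `α`, with distance function `D`, to the metric space `Y` is a coarse
embedding. It is part of the notion that `D` takes only finite values. -/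
def IsCoarseEmbedding {α Y : Type*} [PseudoMetricSpace Y] (D : α → α → ℝ≥0∞) (f : α → Y) :
    Prop :=
  (∀ x x', D x x' ≠ ∞) ∧
  ∃ ρ₁ ρ₂ : ℝ≥0 → ℝ≥0, Monotone ρ₁ ∧ Monotone ρ₂ ∧
    Filter.Tendsto ρ₁ Filter.atTop Filter.atTop ∧
    ∀ x x', ρ₁ (D x x').toNNReal ≤ nndist (f x) (f x') ∧
      nndist (f x) (f x') ≤ ρ₂ (D x x').toNNReal

end PeriodicSets

end

/-!
The periodic sets in the family are uniformly spread over `ℝ^d`, all with the same density, and two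
such sets are matched by a bijection of bounded displacement; the isometry is not needed.

*Spreading.* Call `X` equidistributed with density `κ` at scale `D` if every set `A` satisfies
`#(X ∩ A) ≤ κ vol(A_D)` and `κ vol(A) ≤ #(X ∩ A_D)`, where `A_D` is the closed `D`-thickening
(`IsEquidistributed`). If `X = Λ + P`, every fundamental domain `F` of `Λ` has the volume of the unit
cell and contains `|P|` points of `X`, because both Lebesgue measure and the counting measure of `X`
are `Λ`-invariant. Rounding `A` up to the union of the translates of `F` that meet it shows that `X`
is equidistributed with density `|P| / vol(U)` at scale `2r` if `F` lies in a ball of radius `r`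
(`IsRepresentedBy.isEquidistributed`).

*A uniform scale.* It remains to find `F` in a ball of bounded radius. Join two points of the motif
if some of their translates are close. As the balls of radius `R` around `X` cover the connected
space `ℝ^d`, this graph is connected, and its paths have fewer than `|P| ≤ N` edges; so `Λ` itself
has covering radius at most `3RN` (`IsRepresentedBy.exists_vadd_mem_closedBall`). Choosing from every
`Λ`-orbit its first point in that ball yields a measurable fundamental domain
(`exists_fundamentalDomain_subset`). The representatives that compute the density may differ from
those with a small motif, but comparing counts in large balls shows that the density of an
equidistributed set is unique (`IsEquidistributed.density_le`).

*Matching.* If `X` and `Y` are equidistributed with density `κ` at scales `D` and `D'`, then a finite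
`S ⊆ X` satisfies `|S| ≤ κ vol(S_D) ≤ #(Y ∩ S_{D + D'})`. This is Hall's condition, so there is an
injection `X → Y` with displacement at most `D + D'`, and likewise one `Y → X`; the
Schröder–Bernstein construction merges them into a bijection with the same bound
(`IsEquidistributed.bottleneckDist_le`).

Once distances are bounded by `K`, a constant map is a coarse embedding with lower control function
`t ↦ max (t - K) 0` and upper control function `0`.
-/

namespace PeriodicSets

open MeasureTheory Metric Set

/-! ### Fundamental domains inside a prescribed set -/

/-- If a measurable set `B` meets every orbit of a countable group that has a measurable fundamental
domain `U`, then `B` contains a measurable fundamental domain: along an enumeration of the group, the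
first translate of each point of `U` that lies in `B`. -/
theorem exists_fundamentalDomain_subset {G α : Type*} [AddGroup G] [Countable G] [AddAction G α]
    [MeasurableSpace α] [MeasurableConstVAdd G α] {U B : Set α} (hUm : MeasurableSet U)
    (hBm : MeasurableSet B) (hU : ∀ x : α, ∃! g : G, g +ᵥ x ∈ U)
    (hB : ∀ x : α, ∃ g : G, g +ᵥ x ∈ B) :
    ∃ F ⊆ B, MeasurableSet F ∧ ∀ x : α, ∃! g : G, g +ᵥ x ∈ F := by
  obtain ⟨e, he⟩ := Countable.exists_injective_nat G
  refine ⟨B ∩ ⋃ g : G, {x | g +ᵥ x ∈ U} ∩ ⋂ h : G, ⋂ _ : e h < e g, {x | (-h + g) +ᵥ x ∈ B}ᶜ,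
    inter_subset_left, ?_, fun y => ?_⟩
  · refine hBm.inter (.iUnion fun g => ((measurable_const_vadd g) hUm).inter ?_)
    exact .iInter fun h => .iInter fun _ => ((measurable_const_vadd (-h + g)) hBm).compl
  · obtain ⟨k, hk, hk'⟩ := hU y
    have hne : {h : G | (-h + k) +ᵥ y ∈ B}.Nonempty := by
      obtain ⟨g, hg⟩ := hB y
      exact ⟨k - g, by simpa [sub_eq_add_neg] using hg⟩
    -- With `k +ᵥ y` the point of the orbit in `U`, the translates of `y` in the new domain
    -- are the `(-g + k) +ᵥ y` with `g` first in the enumeration among those landing in `B`.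
    have key : ∀ a : G, (a +ᵥ y ∈ B ∩ ⋃ g : G, {x | g +ᵥ x ∈ U} ∩
        ⋂ h : G, ⋂ _ : e h < e g, {x | (-h + g) +ᵥ x ∈ B}ᶜ) ↔
        ∃ g : G, a = -g + k ∧ (-g + k) +ᵥ y ∈ B ∧ ∀ h, e h < e g → (-h + k) +ᵥ y ∉ B := by
      intro a
      simp only [mem_inter_iff, mem_iUnion, mem_iInter, mem_compl_iff, mem_ofPred_eq, vadd_vadd]
      constructor
      · rintro ⟨haB, g, hgU, hg⟩
        have hgk : g + a = k := hk' _ hgU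
        have ha : a = -g + k := by rw [← hgk]; simp
        refine ⟨g, ha, ha ▸ haB, fun h hh => ?_⟩
        have := hg h hh
        rwa [add_assoc, hgk] at this
      · rintro ⟨g, rfl, h1, h2⟩
        refine ⟨h1, g, by simpa using hk, fun h hh => ?_⟩
        have := h2 h hh
        rwa [add_assoc, add_neg_cancel_left]
    obtain ⟨g, hg, hmin⟩ := exists_minimalFor_of_wellFoundedLT (fun h => (-h + k) +ᵥ y ∈ B) e hne
    have hlt : ∀ h, e h < e g → (-h + k) +ᵥ y ∉ B := fun h hh hB' =>
      absurd (hmin hB' hh.le) (not_le.2 hh)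
    refine ⟨-g + k, (key _).2 ⟨g, rfl, hg, hlt⟩, fun a ha => ?_⟩
    obtain ⟨g', rfl, h1, h2⟩ := (key a).1 ha
    have : g' = g := he (le_antisymm (not_lt.1 fun h => h2 _ h hg) (not_lt.1 fun h => hlt _ h h1))
    rw [this]

/-! ### Equidistribution of periodic point sets -/

/-- The number of points of `X` in a set `A` is `κ` times the volume of `A`, up to closed
`D`-thickenings of `A` on either side. Points are counted by the counting measure restricted to `X`,
and `A` need not be measurable, so the measures are applied as outer measures. -/
structure IsEquidistributed {d : ℕ} (X : Set (Space d)) (κ : ℝ≥0∞) (D : ℝ) : Prop where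
  count_le (A : Set (Space d)) : Measure.count.restrict X A ≤ κ * volume (cthickening D A)
  le_count (A : Set (Space d)) : κ * volume A ≤ Measure.count.restrict X (cthickening D A)

theorem volume_unitCell_ne_zero {d : ℕ} (v : Module.Basis (Fin d) ℝ (Space d)) :
    volume (unitCell v) ≠ 0 :=
  ZSpan.measure_fundamentalDomain_ne_zero v

theorem volume_unitCell_ne_top {d : ℕ} (v : Module.Basis (Fin d) ℝ (Space d)) :
    volume (unitCell v) ≠ ∞ :=
  (ZSpan.fundamentalDomain_isBounded v).measure_lt_top.ne

/-- A `Λ`-invariant measure gives the union of any family of translates of a fundamental domain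
`F` of `Λ` as many times the mass of the unit cell as there are translates. -/
theorem measure_cells {d : ℕ} {v : Module.Basis (Fin d) ℝ (Space d)} {F : Set (Space d)}
    (μ : Measure (Space d)) [VAddInvariantMeasure (Submodule.span ℤ (range v)) (Space d) μ]
    (hFm : MeasurableSet F)
    (hF : ∀ x : Space d, ∃! g : Submodule.span ℤ (range v), g +ᵥ x ∈ F)
    (J : Set (Submodule.span ℤ (range v))) :
    μ (⋃ g ∈ J, g +ᵥ F) = ENat.card J * μ (unitCell v) := by
  have hfd : IsAddFundamentalDomain (Submodule.span ℤ (range v)) F μ :=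
    .mk' hFm.nullMeasurableSet hF
  have hFU : μ F = μ (unitCell v) := hfd.measure_eq (ZSpan.isAddFundamentalDomain v μ)
  rw [measure_biUnion₀ (to_countable J) (hfd.aedisjoint.set_pairwise J)
    fun g _ => (hFm.const_vadd g).nullMeasurableSet]
  simp [measure_vadd, hFU, ENNReal.tsum_const]

namespace IsRepresentedBy

variable {d : ℕ} {X : Set (Space d)} {v : Module.Basis (Fin d) ℝ (Space d)} {P : Finset (Space d)}

theorem mem_iff (h : IsRepresentedBy X v P) {x : Space d} :
    x ∈ X ↔ ∃ l ∈ Submodule.span ℤ (range v), ∃ p ∈ P, l + p = x := by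
  rw [h.eq_add]; simp [lattice, mem_add]

theorem countable (h : IsRepresentedBy X v P) : X.Countable := by
  rw [h.eq_add, ← image2_add]
  exact Countable.image2
    (countable_coe_iff.1 (inferInstanceAs (Countable (Submodule.span ℤ (range v)))))
    P.countable_toSet _

theorem vadd_mem_iff (h : IsRepresentedBy X v P) (g : Submodule.span ℤ (range v)) {x : Space d} :
    g +ᵥ x ∈ X ↔ x ∈ X := by
  have key : ∀ (g : Submodule.span ℤ (range v)) {x : Space d}, x ∈ X → g +ᵥ x ∈ X := by
    intro g x hx
    obtain ⟨l, hl, p, hp, rfl⟩ := h.mem_iff.1 hx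
    exact h.mem_iff.2 ⟨g + l, add_mem g.2 hl, p, hp, add_assoc _ _ _⟩
  exact ⟨fun hx => by simpa using key (-g) hx, key g⟩

theorem inter_unitCell (h : IsRepresentedBy X v P) : unitCell v ∩ X = P := by
  ext x
  constructor
  · rintro ⟨hxU, hxX⟩
    obtain ⟨l, hl, p, hp, rfl⟩ := h.mem_iff.1 hxX
    have h1 := ZSpan.fract_eq_self.2 hxU
    rw [ZSpan.fract_zSpan_add _ _ hl, ZSpan.fract_eq_self.2 (h.motif_subset hp)] at h1
    rwa [← h1]
  · exact fun hx => ⟨h.motif_subset hx, h.mem_iff.2 ⟨0, zero_mem _, x, hx, zero_add x⟩⟩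

theorem count_unitCell (h : IsRepresentedBy X v P) :
    Measure.count.restrict X (unitCell v) = P.card := by
  rw [Measure.restrict_apply' h.countable.measurableSet, h.inter_unitCell,
    Measure.count_apply_finset]

theorem vaddInvariantMeasure_count (h : IsRepresentedBy X v P) :
    VAddInvariantMeasure (Submodule.span ℤ (range v)) (Space d) (Measure.count.restrict X) where
  measure_preimage_vadd g s _ := by
    have hX := h.countable.measurableSet
    rw [Measure.restrict_apply' hX, Measure.restrict_apply' hX]
    rw [← Measure.count_injective_image (AddAction.injective g : Function.Injective
      fun x : Space d => g +ᵥ x)]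
    congr 1
    ext y
    constructor
    · rintro ⟨x, ⟨hx, hxX⟩, rfl⟩
      exact ⟨hx, (h.vadd_mem_iff g).2 hxX⟩
    · rintro ⟨hy, hyX⟩
      exact ⟨-g +ᵥ y, ⟨by simpa using hy, (h.vadd_mem_iff (-g)).2 hyX⟩, by simp⟩

/-- The witness for a set `A` is the union of the translates of `F` that meet `A`: it lies between `A`
and its `2r`-thickening, and the number of points of `X` in it is exactly proportional to its
volume. -/
theorem isEquidistributed (h : IsRepresentedBy X v P) {F : Set (Space d)} {r : ℝ}
    (hFm : MeasurableSet F) (hFr : F ⊆ closedBall 0 r)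
    (hF : ∀ x : Space d, ∃! g : Submodule.span ℤ (range v), g +ᵥ x ∈ F) :
    IsEquidistributed X (P.card / volume (unitCell v)) (2 * r) := by
  have := h.vaddInvariantMeasure_count
  have : VAddInvariantMeasure (Submodule.span ℤ (range v)) (Space d) volume :=
    inferInstanceAs <| VAddInvariantMeasure (Submodule.span ℤ (range v)).toAddSubgroup _ _
  have key : ∀ A : Set (Space d), ∃ B, A ⊆ B ∧ B ⊆ cthickening (2 * r) A ∧
      Measure.count.restrict X B = P.card / volume (unitCell v) * volume B := by
    intro A
    refine ⟨⋃ g ∈ {g : Submodule.span ℤ (range v) | ((g +ᵥ F) ∩ A).Nonempty}, g +ᵥ F,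
      fun x hx => ?_, iUnion₂_subset ?_, ?_⟩
    · obtain ⟨g, hg, -⟩ := hF x
      have hx' : x ∈ -g +ᵥ F := by simpa [mem_vadd_set_iff_neg_vadd_mem] using hg
      exact mem_biUnion (x := -g) ⟨x, hx', hx⟩ hx'
    · rintro g ⟨y, hyF, hyA⟩ x hx
      obtain ⟨x, hx, rfl⟩ := hx
      obtain ⟨y, hy, rfl⟩ := hyF
      refine mem_cthickening_of_dist_le _ _ _ _ hyA ?_
      have h1 := mem_closedBall_zero_iff.1 (hFr hx)
      have h2 := mem_closedBall_zero_iff.1 (hFr hy)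
      have h3 := norm_sub_le x y
      change dist ((g : Space d) + x) (g + y) ≤ 2 * r
      rw [dist_add_left, dist_eq_norm]
      linarith
    · rw [measure_cells _ hFm hF, measure_cells _ hFm hF, h.count_unitCell, mul_left_comm,
        ENNReal.div_mul_cancel (volume_unitCell_ne_zero v) (volume_unitCell_ne_top v)]
  constructor <;> intro A <;> obtain ⟨B, hAB, hBA, hB⟩ := key A
  · calc _ ≤ _ := measure_mono hAB
      _ = _ := hB
      _ ≤ _ := by gcongr
  · calc _ ≤ _ := by gcongr
      _ = _ := hB.symm
      _ ≤ _ := measure_mono hBA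

end IsRepresentedBy

/-! ### Uniqueness of the density -/

/-- Counting points in the ball of radius `T` gives `κ ≤ κ' (1 + (D + D') / T) ^ d`; let `T → ∞`. -/
theorem IsEquidistributed.density_le {d : ℕ} {X : Set (Space d)} {κ κ' : ℝ≥0∞} {D D' : ℝ}
    (h : IsEquidistributed X κ D) (h' : IsEquidistributed X κ' D') (hD : 0 ≤ D) (hD' : 0 ≤ D') :
    κ ≤ κ' := by
  have key : ∀ T : ℝ, 0 < T → κ ≤ κ' * ENNReal.ofReal ((1 + (D + D') / T) ^ d) := by
    intro T hT
    have h1 : κ * volume (closedBall (0 : Space d) T) ≤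
        κ' * volume (closedBall (0 : Space d) (T + (D + D'))) := by
      refine (h.le_count _).trans ((h'.count_le _).trans ?_)
      gcongr
      rw [cthickening_closedBall hD hT.le, cthickening_closedBall hD' (by positivity)]
      exact closedBall_subset_closedBall (by linarith)
    have e : T + (D + D') = (1 + (D + D') / T) * T := by field_simp
    have hpos : 0 ≤ 1 + (D + D') / T := by positivity
    rw [e, Measure.addHaar_closedBall_mul _ _ hpos hT.le, finrank_euclideanSpace_fin,
      ← mul_assoc] at h1
    exact (ENNReal.mul_le_mul_iff_left (measure_closedBall_pos _ _ hT).ne'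
      measure_closedBall_lt_top.ne).1 h1
  have hlim : Filter.Tendsto (fun T : ℝ => κ' * ENNReal.ofReal ((1 + (D + D') / T) ^ d))
      Filter.atTop (nhds (κ' * ENNReal.ofReal ((1 + 0) ^ d))) := by
    refine ENNReal.Tendsto.const_mul (ENNReal.tendsto_ofReal ?_) (by simp)
    exact ((Filter.tendsto_id.const_div_atTop _).const_add 1).pow d
  have := ge_of_tendsto hlim ((Filter.eventually_gt_atTop 0).mono key)
  simpa using this

/-! ### Bijections of bounded displacement -/

/-- Hall's marriage theorem, applied to the pairs of points at distance at most `D + D'`. -/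
theorem IsEquidistributed.exists_injective {d : ℕ} {X Y : Set (Space d)} {κ : ℝ≥0∞} {D D' : ℝ}
    (hκ : κ ≠ ∞) (hX : IsEquidistributed X κ D) (hY : IsEquidistributed Y κ D') (hYc : Y.Countable)
    (hD : 0 ≤ D) (hD' : 0 ≤ D') :
    ∃ f : X → Y, Function.Injective f ∧ ∀ x : X, dist (x : Space d) (f x) ≤ D + D' := by
  classical
  have hfin : ∀ x : X, {y : Y | dist (x : Space d) y ≤ D + D'}.Finite := by
    intro x
    have h1 : Measure.count (closedBall (x : Space d) (D + D') ∩ Y) < ∞ := by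
      rw [← Measure.restrict_apply' hYc.measurableSet]
      exact (hY.count_le _).trans_lt
        (ENNReal.mul_lt_top hκ.lt_top isBounded_closedBall.cthickening.measure_lt_top)
    refine ((Measure.count_apply_lt_top.1 h1).preimage Subtype.val_injective.injOn).subset ?_
    exact fun y hy => ⟨by rwa [mem_closedBall'], y.2⟩
  obtain ⟨f, hf, hf'⟩ := (Finset.all_card_le_biUnion_card_iff_exists_injective
    fun x => (hfin x).toFinset).1 fun s => by
      set S : Set (Space d) := Subtype.val '' (s : Set X) with hS
      set T : Set (Space d) :=
        Subtype.val '' ((s.biUnion fun x => (hfin x).toFinset : Finset Y) : Set Y)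
      have hST : cthickening (D' + D) S ∩ Y ⊆ T := by
        rintro y ⟨hy, hyY⟩
        rw [(s.finite_toSet.image _).isCompact.cthickening_eq_biUnion_closedBall (by positivity)]
          at hy
        simp only [mem_iUnion] at hy
        obtain ⟨_, ⟨x, hx, rfl⟩, hxy⟩ := hy
        refine ⟨⟨y, hyY⟩, ?_, rfl⟩
        simp only [Finset.coe_biUnion, mem_iUnion, Finite.coe_toFinset]
        refine ⟨x, hx, ?_⟩
        change dist (x : Space d) y ≤ D + D'
        rw [add_comm, dist_comm]; exact hxy
      have hSX : S ⊆ X := by rintro _ ⟨x, -, rfl⟩; exact x.2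
      have h1 : Measure.count S ≤ Measure.count T :=
        calc Measure.count S = Measure.count (S ∩ X) := by rw [inter_eq_left.2 hSX]
          _ ≤ Measure.count.restrict X S := Measure.le_restrict_apply _ _
          _ ≤ κ * volume (cthickening D S) := hX.count_le _
          _ ≤ Measure.count.restrict Y (cthickening D' (cthickening D S)) := hY.le_count _
          _ ≤ Measure.count.restrict Y (cthickening (D' + D) S) :=
            measure_mono (cthickening_cthickening_subset hD' hD S)
          _ = Measure.count (cthickening (D' + D) S ∩ Y) :=
            Measure.restrict_apply' hYc.measurableSet
          _ ≤ Measure.count T := measure_mono hST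
      have hS' : S = (s.map (Function.Embedding.subtype _) : Finset _) := by simp [hS]
      have hT' : T = ((s.biUnion fun x => (hfin x).toFinset).map (Function.Embedding.subtype _) :
        Finset _) := by rw [Finset.coe_map]; rfl
      rw [hS', hT', Measure.count_apply_finset, Measure.count_apply_finset, Finset.card_map,
        Finset.card_map] at h1
      exact_mod_cast h1
  exact ⟨f, hf, fun x => by simpa using hf' x⟩

/-- The injections `X → Y` and `Y → X` of bounded displacement combine to a bijection by the
Schröder–Bernstein theorem, whose bijection uses only pairs matched by one of the two. -/
theorem IsEquidistributed.bottleneckDist_le {d : ℕ} {X Y : Set (Space d)} {κ : ℝ≥0∞} {D D' : ℝ}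
    (hκ : κ ≠ ∞) (hX : IsEquidistributed X κ D) (hY : IsEquidistributed Y κ D') (hXc : X.Countable)
    (hYc : Y.Countable) (hD : 0 ≤ D) (hD' : 0 ≤ D') :
    bottleneckDist X Y ≤ ENNReal.ofReal (D + D') := by
  obtain ⟨f, hf, hf'⟩ := hX.exists_injective hκ hY hYc hD hD'
  obtain ⟨g, hg, hg'⟩ := hY.exists_injective hκ hX hXc hD' hD
  obtain ⟨φ, hφ, hφ'⟩ := Function.Embedding.schroeder_bernstein_of_rel hf hg
    (fun x y => dist (x : Space d) y ≤ D + D') hf' fun y => by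
      rw [dist_comm, add_comm D]; exact hg' y
  refine iInf_le_of_le (Equiv.ofBijective φ hφ) (iSup_le fun x => ?_)
  rw [edist_dist]
  exact ENNReal.ofReal_le_ofReal (hφ' x)

/-! ### The covering radius of the lattice -/

/-- The graph on the motif `P` in which distinct points `p` and `q` are adjacent if `p` is within
distance `s` of a translate of `q` under the lattice generated by `v`. -/
def motifGraph {d : ℕ} (v : Module.Basis (Fin d) ℝ (Space d)) (P : Finset (Space d))
    (s : ℝ) : SimpleGraph P :=
  .fromRel fun p q => ∃ l ∈ Submodule.span ℤ (range v), dist (p : Space d) (l + q) ≤ s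

theorem exists_dist_lt_of_coveringRadius_lt {d : ℕ} {X : Set (Space d)} {R : ℝ}
    (h : coveringRadius X < ENNReal.ofReal R) (y : Space d) : ∃ x ∈ X, dist y x < R := by
  have h1 : ⨅ x ∈ X, edist y x < ENNReal.ofReal R :=
    (le_iSup (fun y : Space d => ⨅ x ∈ X, edist y x) y).trans_lt h
  obtain ⟨x, hx, hlt⟩ := by simpa only [iInf_lt_iff] using h1
  exact ⟨x, hx, edist_lt_ofReal.1 hlt⟩

namespace IsRepresentedBy

variable {d : ℕ} {X : Set (Space d)} {v : Module.Basis (Fin d) ℝ (Space d)} {P : Finset (Space d)}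

theorem exists_dist_le_of_adj {s : ℝ} {p q : P} (h : (motifGraph v P s).Adj p q) :
    ∃ l ∈ Submodule.span ℤ (range v), dist (p : Space d) (l + q) ≤ s := by
  obtain ⟨-, h | ⟨l, hl, h⟩⟩ := (SimpleGraph.fromRel_adj _ _ _).1 h
  · exact h
  · refine ⟨-l, neg_mem hl, ?_⟩
    rwa [← dist_add_left l, add_neg_cancel_left, dist_comm]

theorem exists_dist_le_of_walk {s : ℝ} {p q : P} (w : (motifGraph v P s).Walk p q) :
    ∃ l ∈ Submodule.span ℤ (range v), dist (p : Space d) (l + q) ≤ s * w.length := by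
  induction w with
  | nil => exact ⟨0, zero_mem _, by simp⟩
  | @cons p q r h w ih =>
    obtain ⟨l, hl, hpq⟩ := exists_dist_le_of_adj h
    obtain ⟨l', hl', hqr⟩ := ih
    refine ⟨l + l', add_mem hl hl', ?_⟩
    have := dist_triangle (p : Space d) (l + q) (l + l' + r)
    rw [add_assoc, dist_add_left] at this
    rw [SimpleGraph.Walk.length_cons, add_assoc]
    push_cast
    linarith

/-- If the balls of radius `R` around `X` cover the space, then the motif graph at scale `3R` is
connected: walk along the segment from `y` to `z` in steps of length at most `R`. The points `p` and
`q` only enter through translates close to the endpoints. -/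
theorem reachable_motifGraph (h : IsRepresentedBy X v P) {R : ℝ}
    (hX : ∀ y : Space d, ∃ x ∈ X, dist y x < R) {y z : Space d} {p q : P} {l m : Space d}
    (hl : l ∈ Submodule.span ℤ (range v)) (hm : m ∈ Submodule.span ℤ (range v))
    (hy : dist y (l + p) < R) (hz : dist z (m + q) < R) :
    (motifGraph v P (3 * R)).Reachable p q := by
  have hR : 0 < R := dist_nonneg.trans_lt hy
  -- Points of space at distance at most `R` see equal or adjacent points of the motif.
  have step : ∀ {y z : Space d} {p q : P} {l m : Space d}, l ∈ Submodule.span ℤ (range v) →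
      m ∈ Submodule.span ℤ (range v) → dist y (l + p) < R → dist z (m + q) < R →
      dist y z ≤ R → (motifGraph v P (3 * R)).Reachable p q := by
    intro y z p q l m hl hm hy hz hyz
    by_cases hpq : p = q
    · rw [hpq]
    refine SimpleGraph.Adj.reachable ((SimpleGraph.fromRel_adj _ _ _).2
      ⟨hpq, .inl ⟨m - l, sub_mem hm hl, ?_⟩⟩)
    have h1 : dist (p : Space d) (m - l + q) = dist (l + p) (m + q) := by
      rw [← dist_add_left l]; congr 1; abel
    have h2 := dist_triangle4 (l + p : Space d) y z (m + q)
    rw [dist_comm _ y] at h2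
    linarith
  obtain ⟨n, hn⟩ := exists_nat_gt (dist y z / R)
  have hn0 : (0 : ℝ) < n := (by positivity : 0 ≤ dist y z / R).trans_lt hn
  have hseg : ∀ k : ℕ, ∀ (r : P) (m : Space d), m ∈ Submodule.span ℤ (range v) →
      dist (AffineMap.lineMap y z (k / n : ℝ) : Space d) (m + r) < R →
      (motifGraph v P (3 * R)).Reachable p r := by
    intro k
    induction k with
    | zero =>
      intro r m hm hr
      refine step hl hm hy hr ?_
      simpa using hR.le
    | succ k ih =>
      intro r m hm hr
      obtain ⟨x, hx, hxR⟩ := hX (AffineMap.lineMap y z (k / n : ℝ))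
      obtain ⟨m', hm', p', hp', rfl⟩ := h.mem_iff.1 hx
      refine (ih ⟨p', hp'⟩ m' hm' hxR).trans (step hm' hm hxR hr ?_)
      rw [dist_lineMap_lineMap, Real.dist_eq, ← sub_div, Nat.cast_succ, sub_add_cancel_left,
        abs_div, abs_neg, abs_one, Nat.abs_cast]
      rw [div_lt_iff₀ hR] at hn
      rw [one_div, inv_mul_le_iff₀ hn0]
      exact hn.le
  refine hseg n q m hm ?_
  rwa [div_self hn0.ne', AffineMap.lineMap_apply_one]

/-- The lattice has covering radius at most `3R|P|`: a path in the motif graph has at most `|P| - 1`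
edges of length `3R`, and the two ends of the path add less than `R` each. -/
theorem exists_vadd_mem_closedBall (h : IsRepresentedBy X v P) {R : ℝ}
    (hX : ∀ y : Space d, ∃ x ∈ X, dist y x < R) (y : Space d) :
    ∃ g : Submodule.span ℤ (range v), g +ᵥ y ∈ closedBall (0 : Space d) (3 * R * P.card) := by
  obtain ⟨x, hx, hxR⟩ := hX y
  obtain ⟨l, hl, p, hp, rfl⟩ := h.mem_iff.1 hx
  obtain ⟨x, hx, hzR⟩ := hX 0
  obtain ⟨m, hm, q, hq, rfl⟩ := h.mem_iff.1 hx
  have hR : 0 < R := dist_nonneg.trans_lt hxR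
  obtain ⟨w, hw⟩ := (h.reachable_motifGraph hX (p := ⟨p, hp⟩) (q := ⟨q, hq⟩)
    hl hm hxR hzR).exists_isPath
  have hlen : (w.length : ℝ) + 1 ≤ P.card := by
    have := hw.length_lt
    rw [Fintype.card_coe] at this
    exact_mod_cast this
  obtain ⟨k, hk, hpq⟩ := exists_dist_le_of_walk w
  refine ⟨⟨m - l - k, sub_mem (sub_mem hm hl) hk⟩, ?_⟩
  have e : (m - l - k + y : Space d) = (y - (l + p)) + (p - (k + q)) + ((m + q) - 0) := by abel
  have hb := norm_add₃_le (a := y - (l + p)) (b := p - (k + q)) (c := (m + q) - 0)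
  rw [mem_closedBall_zero_iff]
  change ‖m - l - k + y‖ ≤ _
  rw [e]
  rw [dist_comm] at hzR
  rw [dist_eq_norm] at hxR hzR hpq
  nlinarith

/-- Without a bound on the covering radius, the unit cell itself serves as fundamental domain, and
the scale is not controlled. -/
theorem exists_isEquidistributed (h : IsRepresentedBy X v P) :
    ∃ D, 0 ≤ D ∧ IsEquidistributed X (P.card / volume (unitCell v)) D := by
  obtain ⟨r, hr, hU⟩ := (ZSpan.fundamentalDomain_isBounded v).subset_closedBall_lt 0 0
  exact ⟨2 * r, by positivity, h.isEquidistributed (ZSpan.fundamentalDomain_measurableSet v) hU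
    (ZSpan.exist_unique_vadd_mem_fundamentalDomain v)⟩

theorem isEquidistributed_of_coveringRadius_lt (h : IsRepresentedBy X v P) {R : ℝ}
    (hX : coveringRadius X < ENNReal.ofReal R) :
    IsEquidistributed X (P.card / volume (unitCell v)) (2 * (3 * R * P.card)) := by
  obtain ⟨F, hFB, hFm, hF⟩ := exists_fundamentalDomain_subset
    (ZSpan.fundamentalDomain_measurableSet v) measurableSet_closedBall
    (ZSpan.exist_unique_vadd_mem_fundamentalDomain v)
    (h.exists_vadd_mem_closedBall (exists_dist_lt_of_coveringRadius_lt hX))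
  exact h.isEquidistributed hFm hFB hF

end IsRepresentedBy

/-! ### The family of sets with bounded motif -/

theorem IsEquidistributed.mono {d : ℕ} {X : Set (Space d)} {κ : ℝ≥0∞} {D D' : ℝ}
    (h : IsEquidistributed X κ D) (hDD' : D ≤ D') : IsEquidistributed X κ D' where
  count_le A := (h.count_le A).trans (by gcongr; exact cthickening_mono hDD' A)
  le_count A := (h.le_count A).trans (measure_mono (cthickening_mono hDD' A))

/-- The scale comes from the representatives with at most `N` motif points, the density from those
that compute `κ`; the two densities agree by `IsEquidistributed.density_le`. -/
theorem isEquidistributed_of_mem_boundedMotifSets {d N : ℕ} {κ R : ℝ} (hR : 0 < R)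
    {X : Set (Space d)} (hX : X ∈ boundedMotifSets d κ R N) :
    IsEquidistributed X (ENNReal.ofReal κ) (6 * R * N) := by
  obtain ⟨⟨-, ⟨v, P, h, hκ⟩, hXR⟩, v', P', h', hN⟩ := hX
  have hU : 0 < volume.real (unitCell v) :=
    ENNReal.toReal_pos (volume_unitCell_ne_zero v) (volume_unitCell_ne_top v)
  have hκ' : ENNReal.ofReal κ = P.card / volume (unitCell v) := by
    rw [hκ, ENNReal.ofReal_div_of_pos hU,
      ENNReal.ofReal_natCast, ofReal_measureReal (volume_unitCell_ne_top v)]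
  obtain ⟨D, hD, hv⟩ := h.exists_isEquidistributed
  have hv' := h'.isEquidistributed_of_coveringRadius_lt hXR
  have hD' : 0 ≤ 2 * (3 * R * P'.card) := by positivity
  rw [hκ', (hv.density_le hv' hD hD').antisymm (hv'.density_le hv hD' hD)]
  refine hv'.mono ?_
  have : (P'.card : ℝ) ≤ N := by exact_mod_cast hN
  nlinarith

theorem euclideanBottleneckDist_le_bottleneckDist {d : ℕ} (X Y : Set (Space d)) :
    euclideanBottleneckDist X Y ≤ bottleneckDist X Y := by
  refine iInf_le_of_le (IsometryEquiv.refl _) ?_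
  rw [show (IsometryEquiv.refl (Space d)) '' Y = Y from image_id Y]

theorem euclideanBottleneckDist_le_of_mem_boundedMotifSets {d N : ℕ} {κ R : ℝ} (hR : 0 < R)
    {X Y : Set (Space d)} (hX : X ∈ boundedMotifSets d κ R N)
    (hY : Y ∈ boundedMotifSets d κ R N) :
    euclideanBottleneckDist X Y ≤ ENNReal.ofReal (12 * R * N) := by
  have hXc : X.Countable := let ⟨_, _, _, h, _⟩ := hX; h.countable
  have hYc : Y.Countable := let ⟨_, _, _, h, _⟩ := hY; h.countable
  have hD : 0 ≤ 6 * R * N := by positivity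
  refine (euclideanBottleneckDist_le_bottleneckDist X Y).trans ?_
  refine ((isEquidistributed_of_mem_boundedMotifSets hR hX).bottleneckDist_le ENNReal.ofReal_ne_top
    (isEquidistributed_of_mem_boundedMotifSets hR hY) hXc hYc hD hD).trans_eq ?_
  congr 1
  ring

/-- The lower control function is `t ↦ t - K` with truncated subtraction, which vanishes on all
distances that occur. -/
theorem isCoarseEmbedding_const {α Y : Type*} [PseudoMetricSpace Y] {D : α → α → ℝ≥0∞} {K : ℝ≥0}
    (hD : ∀ x x', D x x' ≤ K) (y : Y) : IsCoarseEmbedding D fun _ => y := by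
  refine ⟨fun x x' => ((hD x x').trans_lt ENNReal.coe_lt_top).ne, fun t => t - K, fun _ => 0,
    fun s t hst => tsub_le_tsub_right hst K, monotone_const, ?_, fun x x' => ?_⟩
  · refine Filter.tendsto_atTop.2 fun b => ?_
    filter_upwards [Filter.eventually_ge_atTop (b + K)] with t ht using le_tsub_of_add_le_right ht
  · have : (D x x').toNNReal ≤ K := ENNReal.toNNReal_mono ENNReal.coe_ne_top (hD x x')
    simp [tsub_eq_zero_of_le this]

end PeriodicSets

open PeriodicSets in
theorem mainTheorem3 (d N : ℕ) (κ R : ℝ) (hκ : 0 < κ) (hR : 0 < R) :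
    (∃ K : ℝ, 0 < K ∧
      ∀ X₁ ∈ boundedMotifSets d κ R N, ∀ X₂ ∈ boundedMotifSets d κ R N,
        euclideanBottleneckDist X₁ X₂ ≤ ENNReal.ofReal K) ∧
    (∀ (H : Type*) [NormedAddCommGroup H] [InnerProductSpace ℝ H] [CompleteSpace H] (h : H),
      IsCoarseEmbedding
        (fun X Y : boundedMotifSets d κ R N =>
          euclideanBottleneckDist (X : Set (Space d)) (Y : Set (Space d)))
        (fun _ => h)) := by
  -- The summand `1` only serves to make the bound positive when `N = 0`.
  refine ⟨⟨12 * R * N + 1, by positivity, fun X₁ h₁ X₂ h₂ => ?_⟩, fun H _ _ _ h => ?_⟩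
  · exact (euclideanBottleneckDist_le_of_mem_boundedMotifSets hR h₁ h₂).trans
      (ENNReal.ofReal_le_ofReal (by linarith))
  · exact isCoarseEmbedding_const (K := (12 * R * N).toNNReal)
      (fun X Y => euclideanBottleneckDist_le_of_mem_boundedMotifSets hR X.2 Y.2) h
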